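/- Let $\mathfrak g$ be a Lie algebra of $H$-type: a finite-dimensional real Lie algebra with center $\mathfrak z\neq 0$ and an inner product $\langle\cdot,\cdot\rangle$ (with norm $|\cdot|$) such that $[\mathfrak z^\perp,\mathfrak z^\perp]=\mathfrak z$ and such that, for every $z\in\mathfrak z$ with $|z|=1$, the linear map $J_z:\mathfrak z^\perp\to\mathfrak z^\perp$ given by $\langle J_zx,y\rangle=\langle z,[x,y]\rangle$ for $x,y\in\mathfrak z^\perp$ is orthogonal. Let $G$ be the corresponding $H$-type group, identified with $\mathfrak g=\mathfrak z^\perp\oplus\mathfrak z$ and equipped with the law $(x,z)\cdot(y,z')=(x+y,\,z+z'+\tfrac12[x,y])$. Let $X_1,\dots,X_{2n}$ be the left-invariant vector fields on $G$ whose values at the identity $0$ form an orthonormal basis of $\mathfrak z^\perp$. For $(x,z)\in G$ let $d(x,z)$ be the Carnot–Carathéodory distance from $0$ to $(x,z)$, that is, the infimum of $$|\gamma|=\int_0^1\Bigl(\sum_{j=1}^{2n}|a_j(t)|^2\Bigr)^{1/2}\,dt$$ over all absolutely continuous curves $\gamma:[0,1]\to G$ with $\gamma(0)=0$, $\gamma(1)=(x,z)$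 and $\gamma'(t)=\sum_{j=1}^{2n}a_j(t)X_j(\gamma(t))$ for almost every $t\in[0,1]$. Then, for every $(x,z)\in G$, $$\frac{\pi}{4}\bigl(|x|^2+4|z|\bigr)\le d(x,z)^2\le\pi\bigl(|x|^2+4|z|\bigr),$$ and the constants are optimal: $\pi/4$ is the largest real number $c$ such that $c(|x|^2+4|z|)\le d(x,z)^2$ for all $(x,z)\in G$, and $\pi$ is the smallest real number $C$ such that $d(x,z)^2\le C(|x|^2+4|z|)$ for all $(x,z)\in G$. Moreover, for every $\varepsilon\in(0,1)$ and every $(x,z)\in G$, $$(1-\varepsilon)|x|^2+\pi\varepsilon|z|\le d(x,z)^2\le(1+\varepsilon)|x|^2+\frac{20\pi}{\varepsilon}|z|.$$ -/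

import Mathlib

open MeasureTheory Set

namespace HTypeGroup

/-- A real Lie algebra equipped with an inner product. Both structures share the same underlying
real vector space; no compatibility between bracket and inner product is required here. -/
class InnerProductLieAlgebra (𝔤 : Type*) extends
  NormedAddCommGroup 𝔤, InnerProductSpace ℝ 𝔤, LieRing 𝔤, LieAlgebra ℝ 𝔤

noncomputable section
variable (𝔤 : Type*) [InnerProductLieAlgebra 𝔤]

/-- The center `𝔷` of `𝔤`, as a linear subspace. -/
abbrev centerSpace : Submodule ℝ 𝔤 := (LieAlgebra.center ℝ 𝔤).toSubmodule

/-- The horizontal space `𝔷ᗮ`, the orthogonal complement of the center. -/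
abbrev horizontalSpace : Submodule ℝ 𝔤 := (centerSpace 𝔤)ᗮ

/-- `𝔤` is of Heisenberg type: it is finite dimensional, `𝔷 ≠ 0`, `[𝔷ᗮ, 𝔷ᗮ] = 𝔷`, and for every
unit vector `z` of the center the map `J_z` of `𝔷ᗮ` into itself which is determined by
`⟪J_z x, y⟫ = ⟪z, [x, y]⟫` is orthogonal. -/
structure IsHType : Prop where
  finiteDimensional : FiniteDimensional ℝ 𝔤
  center_ne_bot : centerSpace 𝔤 ≠ ⊥
  span_bracket : Submodule.span ℝ
    {w : 𝔤 | ∃ x ∈ horizontalSpace 𝔤, ∃ y ∈ horizontalSpace 𝔤, ⁅x, y⁆ = w} = centerSpace 𝔤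
  orthogonal_J : ∀ z : centerSpace 𝔤, inner ℝ z z = 1 →
    ∃ J : horizontalSpace 𝔤 ≃ₗᵢ[ℝ] horizontalSpace 𝔤, ∀ x y : horizontalSpace 𝔤,
      inner ℝ (J x) y = inner ℝ (z : 𝔤) ⁅(x : 𝔤), (y : 𝔤)⁆
end

noncomputable section
variable {𝔤 : Type*} [InnerProductLieAlgebra 𝔤]

/-- The group law `(x, z) · (y, z') = (x + y, z + z' + [x, y] / 2)` of the connected and simply
connected group of a two-step nilpotent `𝔤`, realised on `𝔤` itself. -/
def mul (g h : 𝔤) : 𝔤 := g + h + (1 / 2 : ℝ) • ⁅g, h⁆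

/-- The value at `g` of the left-invariant vector field whose value at the identity `0` is `v`. -/
def leftField (v g : 𝔤) : 𝔤 := v + (1 / 2 : ℝ) • ⁅g, v⁆

theorem hasDerivAt_mul_smul (v g : 𝔤) :
    HasDerivAt (fun s : ℝ => mul g (s • v)) (leftField v g) 0 := by
  have h : (fun s : ℝ => mul g (s • v)) = fun s : ℝ => g + s • leftField v g := by
    funext s
    simp only [mul, leftField, lie_smul]
    module
  rw [h]
  simpa using ((hasDerivAt_id (0 : ℝ)).smul_const (leftField v g)).const_add g

/-- `γ : [0, 1] → G` is an absolutely continuous horizontal curve with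
`γ'(t) = ∑ j, a_j(t) X_j(γ(t))` for almost every `t ∈ [0, 1]`. The coefficients `a_j(t)` in an
orthonormal basis of `𝔷ᗮ` are collected into the vector `a t` of `𝔷ᗮ`. -/
structure IsHorizontalCurve (γ : ℝ → 𝔤) (a : ℝ → horizontalSpace 𝔤) : Prop where
  absolutelyContinuous : AbsolutelyContinuousOnInterval γ 0 1
  hasDerivAt : ∀ᵐ t : ℝ, t ∈ Icc (0 : ℝ) 1 → HasDerivAt γ (leftField (a t : 𝔤) (γ t)) t

/-- The Carnot–Carathéodory distance from the identity `0` to `g`: the infimum of the lengths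
`∫₀¹ (∑ j, |a_j(t)|²)^(1/2) dt` of the horizontal curves from `0` to `g`. -/
def ccDist (g : 𝔤) : ℝ :=
  sInf {ℓ : ℝ | ∃ (γ : ℝ → 𝔤) (a : ℝ → horizontalSpace 𝔤),
    IsHorizontalCurve γ a ∧ γ 0 = 0 ∧ γ 1 = g ∧ ℓ = ∫ t in (0 : ℝ)..1, ‖a t‖}

end

end HTypeGroup

/-! Both bounds come from one family of circular arcs.

Lower bounds: a calibration along an arbitrary horizontal curve, with arc length entering through a
cotangent, gives `θ cot θ |x|² + 4θ|z| ≤ d²` for every `θ ∈ (0, π)`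
(`IsHorizontalCurve.le_length_sq`, `IsHType.le_ccDist_sq`). The choice `θ = π/4`, where the
cotangent is 1, gives the constant `π/4`; `θ = πε/4` gives the `ε`-version.

Upper bounds: when `z ≠ 0`, the point is the end of a lifted arc with `|x|² = r² sin² θ`, `4|z| = r²
(θ - sin θ cos θ)` and length `θr` (`IsHType.exists_hasLength`). This leaves the one-variable
inequalities `sq_le_pi_mul` and `sq_le_arc`. When `z = 0` a straight segment suffices.

Optimality: the arc with `θ = π/4` satisfies `|x|² + 4|z| = θr²` and has squared length `θ²r²`, so
`π/4` cannot be raised. For `x = 0`, letting `θ → π` in the lower bound gives `4π|z| ≤ d²`, so `π`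
cannot be lowered. -/

/-! ### Absolutely continuous functions. -/

theorem LipschitzOnWith.comp_absolutelyContinuousOnInterval {X Y : Type*} [PseudoMetricSpace X]
    [PseudoMetricSpace Y] {f : X → Y} {K : NNReal} {s : Set X} {g : ℝ → X} {a b : ℝ}
    (hf : LipschitzOnWith K f s) (hg : AbsolutelyContinuousOnInterval g a b)
    (hs : MapsTo g (uIcc a b) s) : AbsolutelyContinuousOnInterval (fun t => f (g t)) a b := by
  rw [absolutelyContinuousOnInterval_iff] at hg ⊢
  intro ε hε
  -- `K + 1` instead of `K` covers `K = 0` and makes the final inequality strict.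
  obtain ⟨δ, hδ, h⟩ := hg (ε / (K + 1)) (by positivity)
  refine ⟨δ, hδ, fun E hE hEδ => ?_⟩
  have h1 := h E hE hEδ
  calc ∑ i ∈ Finset.range E.1, dist (f (g (E.2 i).1)) (f (g (E.2 i).2))
      ≤ ∑ i ∈ Finset.range E.1, (K : ℝ) * dist (g (E.2 i).1) (g (E.2 i).2) := by
        refine Finset.sum_le_sum fun i hi => ?_
        have := hE.1 i hi
        exact hf.dist_le_mul _ (hs this.1) _ (hs this.2)
    _ = K * ∑ i ∈ Finset.range E.1, dist (g (E.2 i).1) (g (E.2 i).2) := by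
        rw [Finset.mul_sum]
    _ ≤ K * (ε / (K + 1)) := by gcongr
    _ < ε := by
        rw [mul_div_assoc', div_lt_iff₀ (by positivity)]
        nlinarith [K.2]

theorem AbsolutelyContinuousOnInterval.le_of_ae_hasDerivAt_nonneg {f : ℝ → ℝ} {a b : ℝ}
    (hab : a ≤ b) (hf : AbsolutelyContinuousOnInterval f a b)
    (h : ∀ᵐ t : ℝ, t ∈ Icc a b → ∃ w, 0 ≤ w ∧ HasDerivAt f w t) : f a ≤ f b := by
  rw [← sub_nonneg, ← hf.integral_deriv_eq_sub]
  refine intervalIntegral.integral_nonneg_of_ae_restrict hab ?_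
  rw [Filter.EventuallyLE, ae_restrict_iff' measurableSet_Icc]
  filter_upwards [h] with t ht htI
  obtain ⟨w, hw, hd⟩ := ht htI
  simpa [hd.deriv] using hw

theorem ContinuousLinearMap.comp_absolutelyContinuousOnInterval {E F : Type*}
    [NormedAddCommGroup E] [NormedSpace ℝ E] [NormedAddCommGroup F] [NormedSpace ℝ F]
    (T : E →L[ℝ] F) {g : ℝ → E} {a b : ℝ} (hg : AbsolutelyContinuousOnInterval g a b) :
    AbsolutelyContinuousOnInterval (fun t => T (g t)) a b :=
  (T.lipschitz.lipschitzOnWith (s := univ)).comp_absolutelyContinuousOnInterval hg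
    (mapsTo_univ _ _)

theorem AbsolutelyContinuousOnInterval.norm_sq {E : Type*} [NormedAddCommGroup E]
    {g : ℝ → E} {a b : ℝ} (hg : AbsolutelyContinuousOnInterval g a b) :
    AbsolutelyContinuousOnInterval (fun t => ‖g t‖ ^ 2) a b := by
  have h1 : AbsolutelyContinuousOnInterval (fun t => ‖g t‖) a b :=
    (lipschitzWith_one_norm.lipschitzOnWith (s := univ)).comp_absolutelyContinuousOnInterval hg
      (mapsTo_univ _ _)
  simpa [pow_two] using h1.fun_mul h1

/-- Coordinates in an orthonormal basis reduce this to real-valued functions, whose derivatives are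
integrable. -/
theorem AbsolutelyContinuousOnInterval.intervalIntegrable_of_ae_hasDerivAt {E : Type*}
    [NormedAddCommGroup E] [InnerProductSpace ℝ E] [FiniteDimensional ℝ E]
    {g g' : ℝ → E} {a b : ℝ} (hg : AbsolutelyContinuousOnInterval g a b)
    (h : ∀ᵐ t : ℝ, t ∈ uIcc a b → HasDerivAt g (g' t) t) : IntervalIntegrable g' volume a b := by
  let B := stdOrthonormalBasis ℝ E
  have hB : g' = ∑ i, fun t => inner ℝ (B i) (g' t) • B i := by
    funext t
    simpa using (B.sum_repr' (g' t)).symm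
  rw [hB]
  refine IntervalIntegrable.sum _ fun i _ => ?_
  have hi : IntervalIntegrable (deriv fun t => inner ℝ (B i) (g t)) volume a b :=
    ((innerSL ℝ (B i)).comp_absolutelyContinuousOnInterval hg).intervalIntegrable_deriv
  have hi' : IntervalIntegrable (fun t => inner ℝ (B i) (g' t)) volume a b := by
    refine hi.congr_ae ?_
    rw [Filter.EventuallyEq, ae_restrict_iff' measurableSet_uIoc]
    filter_upwards [h] with t ht htI
    exact ((innerSL ℝ (B i)).hasFDerivAt.comp_hasDerivAt t (ht (uIoc_subset_uIcc htI))).deriv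
  exact ⟨hi'.1.smul_const _, hi'.2.smul_const _⟩

namespace HTypeGroup

variable {𝔤 : Type*} [InnerProductLieAlgebra 𝔤]

/-! ### Center, horizontal projection and left-invariant fields. -/

theorem coe_center_lie (z : centerSpace 𝔤) (g : 𝔤) : ⁅(z : 𝔤), g⁆ = 0 := by
  have h : (z : 𝔤) ∈ LieAlgebra.center ℝ 𝔤 := z.2
  rw [LieModule.mem_maxTrivSubmodule] at h
  rw [← lie_skew, h g, neg_zero]

theorem IsHType.lie_mem_center (h : IsHType 𝔤) (x y : horizontalSpace 𝔤) :
    ⁅(x : 𝔤), (y : 𝔤)⁆ ∈ centerSpace 𝔤 := by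
  rw [← h.span_bracket]
  exact Submodule.subset_span ⟨x, x.2, y, y.2, rfl⟩

theorem inner_center_horizontal (z : centerSpace 𝔤) (x : horizontalSpace 𝔤) :
    inner ℝ (z : 𝔤) (x : 𝔤) = 0 :=
  Submodule.inner_right_of_mem_orthogonal z.2 x.2

section
variable [FiniteDimensional ℝ 𝔤]

/-- The horizontal component of an element. -/
noncomputable abbrev horizontalPart : 𝔤 →L[ℝ] horizontalSpace 𝔤 :=
  (horizontalSpace 𝔤).orthogonalProjectionOnto

theorem horizontalPart_of_mem_center {z : 𝔤} (hz : z ∈ centerSpace 𝔤) :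
    horizontalPart z = 0 := by
  rw [Submodule.orthogonalProjectionOnto_eq_zero_iff]
  exact Submodule.le_orthogonal_orthogonal _ hz

theorem horizontalPart_add (x : horizontalSpace 𝔤) (z : centerSpace 𝔤) :
    horizontalPart ((x : 𝔤) + (z : 𝔤)) = x := by
  rw [map_add, horizontalPart_of_mem_center z.2, add_zero]
  exact Submodule.orthogonalProjectionOnto_mem_subspace_eq_self x

theorem lie_eq_lie_horizontalPart (g y : 𝔤) : ⁅g, y⁆ = ⁅(horizontalPart g : 𝔤), y⁆ := by
  have h : g - horizontalPart g ∈ centerSpace 𝔤 := by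
    have := (horizontalSpace 𝔤).sub_starProjection_mem_orthogonal g
    rwa [Submodule.orthogonal_orthogonal] at this
  have h2 := coe_center_lie ⟨_, h⟩ y
  rw [← sub_eq_zero, ← sub_lie]
  exact h2

theorem IsHType.horizontalPart_leftField (h : IsHType 𝔤) (a : horizontalSpace 𝔤) (g : 𝔤) :
    horizontalPart (leftField (a : 𝔤) g) = a := by
  have hc : (1 / 2 : ℝ) • ⁅g, (a : 𝔤)⁆ ∈ centerSpace 𝔤 := by
    rw [lie_eq_lie_horizontalPart]
    exact Submodule.smul_mem _ _ (h.lie_mem_center _ _)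
  exact horizontalPart_add a ⟨_, hc⟩

theorem inner_center_leftField {ζ : centerSpace 𝔤} {J : horizontalSpace 𝔤 → horizontalSpace 𝔤}
    (hJ : ∀ x y : horizontalSpace 𝔤, inner ℝ (J x) y = inner ℝ (ζ : 𝔤) ⁅(x : 𝔤), (y : 𝔤)⁆)
    (a : horizontalSpace 𝔤) (g : 𝔤) :
    inner ℝ (ζ : 𝔤) (leftField (a : 𝔤) g) = inner ℝ (J (horizontalPart g)) a / 2 := by
  rw [leftField, inner_add_right, inner_center_horizontal, inner_smul_right,
    lie_eq_lie_horizontalPart, hJ]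
  ring

end

/-! ### Lower bound for the length of horizontal curves. -/

theorem IsHorizontalCurve.hasDerivAt_horizontalPart [FiniteDimensional ℝ 𝔤] (h : IsHType 𝔤)
    {γ : ℝ → 𝔤} {a : ℝ → horizontalSpace 𝔤} (hγ : IsHorizontalCurve γ a) :
    ∀ᵐ t : ℝ, t ∈ Icc (0 : ℝ) 1 → HasDerivAt (fun t => horizontalPart (γ t)) (a t) t := by
  filter_upwards [hγ.hasDerivAt] with t ht htI
  have := (horizontalPart (𝔤 := 𝔤)).hasFDerivAt.comp_hasDerivAt t (ht htI)
  rwa [h.horizontalPart_leftField] at this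

/-- The control is the derivative of the projected curve. Integrability ensures that the length is a
genuine integral and not the default value 0. -/
theorem IsHorizontalCurve.intervalIntegrable [FiniteDimensional ℝ 𝔤] (h : IsHType 𝔤)
    {γ : ℝ → 𝔤} {a : ℝ → horizontalSpace 𝔤} (hγ : IsHorizontalCurve γ a) :
    IntervalIntegrable a volume 0 1 := by
  refine (horizontalPart.comp_absolutelyContinuousOnInterval
    hγ.absolutelyContinuous).intervalIntegrable_of_ae_hasDerivAt ?_
  rw [uIcc_of_le zero_le_one]
  exact hγ.hasDerivAt_horizontalPart h

theorem inner_self_J {ζ : centerSpace 𝔤} {J : horizontalSpace 𝔤 → horizontalSpace 𝔤}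
    (hJ : ∀ x y : horizontalSpace 𝔤, inner ℝ (J x) y = inner ℝ (ζ : 𝔤) ⁅(x : 𝔤), (y : 𝔤)⁆)
    (x : horizontalSpace 𝔤) : inner ℝ (J x) x = 0 := by
  rw [hJ, lie_self, inner_zero_right]

/-- The pointwise inequality behind the lower bound for the length: with `c = cos φ` and
`s = sin φ` it is the expansion of a nonnegative square. -/
theorem calibration_nonneg {E : Type*} [NormedAddCommGroup E] [InnerProductSpace ℝ E]
    {x jx a : E} (hn : ‖jx‖ = ‖x‖) (ho : inner ℝ jx x = 0) {κ c s : ℝ} (hκ : 0 ≤ κ) (hs : 0 < s)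
    (hcs : s ^ 2 + c ^ 2 = 1) :
    0 ≤ ‖a‖ - 2 * κ * inner ℝ jx a - 2 * κ * (c / s) * inner ℝ x a
      + κ ^ 2 / s ^ 2 * ‖a‖ * ‖x‖ ^ 2 := by
  have h1 : ‖s • jx + c • x‖ = ‖x‖ := by
    rw [← sq_eq_sq₀ (norm_nonneg _) (norm_nonneg _), norm_add_sq_real, norm_smul, norm_smul,
      inner_smul_left, inner_smul_right, ho, hn]
    simp only [mul_pow, Real.norm_eq_abs, sq_abs]
    linear_combination ‖x‖ ^ 2 * hcs
  have h2 : s * inner ℝ jx a + c * inner ℝ x a ≤ ‖x‖ * ‖a‖ := by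
    have := real_inner_le_norm (s • jx + c • x) a
    rwa [h1, inner_add_left, real_inner_smul_left, real_inner_smul_left] at this
  have h3 : ‖a‖ - 2 * κ * inner ℝ jx a - 2 * κ * (c / s) * inner ℝ x a
      + κ ^ 2 / s ^ 2 * ‖a‖ * ‖x‖ ^ 2 = ‖a‖ * (1 - κ * ‖x‖ / s) ^ 2
      + 2 * κ / s * (‖x‖ * ‖a‖ - (s * inner ℝ jx a + c * inner ℝ x a)) := by
    field_simp
    ring
  rw [h3]
  have := sub_nonneg.2 h2
  positivity

/-- With `σ` the arc length and `κ = θ / L`, the quantity `σ - 4κ⟪ζ, γ⟫ - κ cot(κσ) |x|²` is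
nondecreasing along the curve, by `calibration_nonneg`. Comparing its endpoint values and
multiplying by `L` gives the claim. -/
theorem IsHorizontalCurve.le_length_sq [FiniteDimensional ℝ 𝔤] (h : IsHType 𝔤)
    {γ : ℝ → 𝔤} {a : ℝ → horizontalSpace 𝔤} (hγ : IsHorizontalCurve γ a) (h0 : γ 0 = 0)
    {ζ : centerSpace 𝔤} {J : horizontalSpace 𝔤 ≃ₗᵢ[ℝ] horizontalSpace 𝔤}
    (hJ : ∀ x y : horizontalSpace 𝔤, inner ℝ (J x) y = inner ℝ (ζ : 𝔤) ⁅(x : 𝔤), (y : 𝔤)⁆)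
    {θ : ℝ} (hθ : 0 < θ) (hθ' : θ < Real.pi) :
    θ * (Real.cos θ / Real.sin θ) * ‖horizontalPart (γ 1)‖ ^ 2 + 4 * θ * inner ℝ (ζ : 𝔤) (γ 1)
      ≤ (∫ t in (0 : ℝ)..1, ‖a t‖) ^ 2 := by
  have hint : IntervalIntegrable (fun t => ‖a t‖) volume 0 1 := (hγ.intervalIntegrable h).norm
  set L := ∫ t in (0 : ℝ)..1, ‖a t‖ with hL
  have hL0 : 0 ≤ L := intervalIntegral.integral_nonneg zero_le_one fun t _ => norm_nonneg _
  -- Starting the arc length at `δ > 0` avoids the pole of the cotangent at 0 and the case `L = 0`;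
  -- `δ → 0` at the end.
  have key : ∀ δ : ℝ, 0 < δ → θ * (Real.cos θ / Real.sin θ) * ‖horizontalPart (γ 1)‖ ^ 2
      + 4 * θ * inner ℝ (ζ : 𝔤) (γ 1) ≤ (δ + L) ^ 2 := by
    intro δ hδ
    have hδL : 0 < δ + L := by positivity
    set κ := θ / (δ + L) with hκ
    have hκ0 : 0 < κ := by positivity
    have hκL : κ * (δ + L) = θ := div_mul_cancel₀ _ hδL.ne'
    let σ : ℝ → ℝ := fun t => δ + ∫ r in (0 : ℝ)..t, ‖a r‖
    have hσ0 : σ 0 = δ := by simp [σ]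
    have hσ1 : σ 1 = δ + L := rfl
    have hσmem : ∀ t ∈ Icc (0 : ℝ) 1, σ t ∈ Icc δ (δ + L) := by
      intro t ht
      refine ⟨le_add_of_nonneg_right
        (intervalIntegral.integral_nonneg ht.1 fun t _ => norm_nonneg _), ?_⟩
      have := intervalIntegral.integral_mono_interval (c := 0) (d := 1) le_rfl ht.1 ht.2
        (Filter.Eventually.of_forall fun r => norm_nonneg (a r)) hint
      simpa only [σ, add_le_add_iff_left] using this
    have hsin : ∀ s ∈ Icc δ (δ + L), 0 < Real.sin (κ * s) := by
      intro s hs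
      refine Real.sin_pos_of_pos_of_lt_pi (mul_pos hκ0 (hδ.trans_le hs.1)) ?_
      exact lt_of_le_of_lt (by rw [← hκL]; gcongr; exact hs.2) hθ'
    have hσac : AbsolutelyContinuousOnInterval σ 0 1 :=
      ((LipschitzWith.const δ).lipschitzOnWith
        (s := uIcc 0 1)).absolutelyContinuousOnInterval.fun_add
        (hint.absolutelyContinuousOnInterval_intervalIntegral (c := 0) (by simp))
    -- The cotangent is smooth on the compact range of `κσ` inside `(0, π)`, hence Lipschitz there,
    -- so its composite with `σ` stays absolutely continuous.
    obtain ⟨K, hK⟩ : ∃ K, LipschitzOnWith K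
        (fun s => Real.cos (κ * s) / Real.sin (κ * s)) (Icc δ (δ + L)) := by
      refine ContDiffOn.exists_lipschitzOnWith (n := 1) ?_ (by decide) (convex_Icc _ _)
        isCompact_Icc
      exact ContDiffOn.div (by fun_prop) (by fun_prop) fun s hs => (hsin s hs).ne'
    have hcotac := hK.comp_absolutelyContinuousOnInterval hσac
      (by rw [uIcc_of_le zero_le_one]; exact hσmem)
    have hX := horizontalPart.comp_absolutelyContinuousOnInterval hγ.absolutelyContinuous
    have hZ := (innerSL ℝ (ζ : 𝔤)).comp_absolutelyContinuousOnInterval hγ.absolutelyContinuous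
    have hW := (hσac.fun_sub (hZ.const_mul (4 * κ))).fun_sub
      ((hcotac.fun_mul hX.norm_sq).const_mul κ)
    have hmono := hW.le_of_ae_hasDerivAt_nonneg zero_le_one (by
      filter_upwards [hγ.hasDerivAt, hγ.hasDerivAt_horizontalPart h,
        hint.ae_hasDerivAt_integral] with t ht htX hts htI
      have hσt := hσmem t htI
      have hs := hsin _ hσt
      have dσ : HasDerivAt σ ‖a t‖ t :=
        (hts (by rwa [uIcc_of_le zero_le_one]) 0 (by simp)).const_add δ
      have dκσ := dσ.const_mul κ
      have dcot := dκσ.cos.fun_div dκσ.sin hs.ne'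
      have dZ := (innerSL ℝ (ζ : 𝔤)).hasFDerivAt.comp_hasDerivAt t (ht htI)
      have dX := (htX htI).norm_sq
      refine ⟨_, ?_, (dσ.fun_sub (dZ.const_mul (4 * κ))).fun_sub
        ((dcot.fun_mul dX).const_mul κ)⟩
      have hcal := calibration_nonneg (a := a t) (J.norm_map (horizontalPart (γ t)))
        (inner_self_J hJ _) hκ0.le hs (Real.sin_sq_add_cos_sq _)
      refine hcal.trans_eq ?_
      rw [innerSL_apply_apply, inner_center_leftField hJ]
      have hsc := Real.sin_sq_add_cos_sq (κ * σ t)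
      field_simp
      linear_combination (-2 * κ ^ 2 * ‖a t‖ * ‖horizontalPart (γ t)‖ ^ 2) * hsc)
    simp only [hσ0, hσ1, h0, map_zero, hκL, innerSL_apply_apply] at hmono
    have h2 : κ * (Real.cos θ / Real.sin θ * ‖horizontalPart (γ 1)‖ ^ 2)
        + 4 * κ * inner ℝ (ζ : 𝔤) (γ 1) ≤ δ + L := by
      simp only [mul_zero, norm_zero, sub_zero, zero_pow two_ne_zero] at hmono
      linarith
    calc _ = (κ * (Real.cos θ / Real.sin θ * ‖horizontalPart (γ 1)‖ ^ 2)
        + 4 * κ * inner ℝ (ζ : 𝔤) (γ 1)) * (δ + L) := by rw [← hκL]; ring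
      _ ≤ (δ + L) * (δ + L) := by gcongr
      _ = _ := by ring
  have hlim : Filter.Tendsto (fun δ : ℝ => (δ + L) ^ 2) (nhdsWithin 0 (Ioi 0)) (nhds (L ^ 2)) := by
    have : Continuous fun δ : ℝ => (δ + L) ^ 2 := by fun_prop
    simpa using (this.tendsto 0).mono_left nhdsWithin_le_nhds
  exact ge_of_tendsto hlim (by filter_upwards [self_mem_nhdsWithin] with δ hδ using key δ hδ)

/-! ### The distance as an infimum of lengths. -/

theorem bddBelow_lengths (g : 𝔤) :
    BddBelow {ℓ : ℝ | ∃ (γ : ℝ → 𝔤) (a : ℝ → horizontalSpace 𝔤),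
      IsHorizontalCurve γ a ∧ γ 0 = 0 ∧ γ 1 = g ∧ ℓ = ∫ t in (0 : ℝ)..1, ‖a t‖} := by
  refine ⟨0, ?_⟩
  rintro _ ⟨γ, a, -, -, -, rfl⟩
  exact intervalIntegral.integral_nonneg zero_le_one fun t _ => norm_nonneg _

theorem ccDist_nonneg (g : 𝔤) : 0 ≤ ccDist g := by
  refine Real.sInf_nonneg ?_
  rintro _ ⟨γ, a, -, -, -, rfl⟩
  exact intervalIntegral.integral_nonneg zero_le_one fun t _ => norm_nonneg _

/-- `g` is joined to `0` by a horizontal curve of length `ℓ`. -/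
def HasLength (g : 𝔤) (ℓ : ℝ) : Prop :=
  ∃ (γ : ℝ → 𝔤) (a : ℝ → horizontalSpace 𝔤),
    IsHorizontalCurve γ a ∧ γ 0 = 0 ∧ γ 1 = g ∧ ℓ = ∫ t in (0 : ℝ)..1, ‖a t‖

theorem HasLength.nonneg {g : 𝔤} {ℓ : ℝ} (h : HasLength g ℓ) : 0 ≤ ℓ := by
  obtain ⟨γ, a, -, -, -, rfl⟩ := h
  exact intervalIntegral.integral_nonneg zero_le_one fun t _ => norm_nonneg _

theorem HasLength.ccDist_sq_le {g : 𝔤} {ℓ : ℝ} (h : HasLength g ℓ) : ccDist g ^ 2 ≤ ℓ ^ 2 :=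
  pow_le_pow_left₀ (ccDist_nonneg g) (csInf_le (bddBelow_lengths g) h) 2

/-- The curve `hg` is needed because the real infimum of the empty set is 0. -/
theorem le_ccDist_sq {g : 𝔤} {b ℓ : ℝ} (hg : HasLength g ℓ)
    (h : ∀ ℓ, HasLength g ℓ → b ≤ ℓ ^ 2) : b ≤ ccDist g ^ 2 := by
  rcases le_or_gt b 0 with hb | hb
  · exact hb.trans (sq_nonneg _)
  · rw [← Real.sqrt_le_left (ccDist_nonneg g)]
    refine le_csInf ⟨ℓ, hg⟩ fun ℓ' hℓ' => ?_
    rw [Real.sqrt_le_left (HasLength.nonneg hℓ')]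
    exact h _ hℓ'

theorem hasLength_horizontal (x : horizontalSpace 𝔤) : HasLength (x : 𝔤) ‖x‖ := by
  have hd : ∀ t : ℝ, HasDerivAt (fun t : ℝ => t • (x : 𝔤)) (x : 𝔤) t := fun t => by
    simpa using (hasDerivAt_id t).smul_const (x : 𝔤)
  refine ⟨fun t => t • (x : 𝔤), fun _ => x, ⟨?_, ?_⟩, by simp, by simp, by simp⟩
  · exact ContDiffOn.absolutelyContinuousOnInterval (by fun_prop)
  · refine Filter.Eventually.of_forall fun t _ => ?_
    convert hd t using 1
    simp [leftField]

/-! ### The complex structures `J` and lifted circular arcs. -/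

section
variable {ζ : centerSpace 𝔤} {J : horizontalSpace 𝔤 ≃ₗᵢ[ℝ] horizontalSpace 𝔤}

/-- `J` is skew because the bracket is, and a skew isometry squares to `-1`. -/
theorem J_J (hJ : ∀ x y : horizontalSpace 𝔤,
      inner ℝ (J x) y = inner ℝ (ζ : 𝔤) ⁅(x : 𝔤), (y : 𝔤)⁆)
    (x : horizontalSpace 𝔤) : J (J x) = -x := by
  refine ext_inner_right ℝ fun y => ?_
  rw [hJ, ← lie_skew, inner_neg_right, ← hJ, J.inner_map_map, inner_neg_left, real_inner_comm]

/-- Let `w = [v, Jv]`. Its component along `ζ` is `|v|²`. The isometry `J'` attached to the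
direction of `w` itself gives `|w| = ⟪J'v, Jv⟫ ≤ |v|²`, so nothing is left orthogonal to `ζ`. -/
theorem IsHType.lie_J (h : IsHType 𝔤) (hζ : inner ℝ ζ ζ = 1)
    (hJ : ∀ x y : horizontalSpace 𝔤, inner ℝ (J x) y = inner ℝ (ζ : 𝔤) ⁅(x : 𝔤), (y : 𝔤)⁆)
    (v : horizontalSpace 𝔤) : ⁅(v : 𝔤), (J v : 𝔤)⁆ = ‖v‖ ^ 2 • (ζ : 𝔤) := by
  set w : centerSpace 𝔤 := ⟨_, h.lie_mem_center v (J v)⟩ with hw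
  have h1 : inner ℝ ζ w = ‖v‖ ^ 2 := by
    change inner ℝ (ζ : 𝔤) ⁅(v : 𝔤), (J v : 𝔤)⁆ = _
    rw [← hJ, real_inner_self_eq_norm_sq, J.norm_map]
  have h2 : ‖w‖ ≤ ‖v‖ ^ 2 := by
    rcases eq_or_ne w 0 with h0 | h0
    · rw [h0, norm_zero]; positivity
    have hn : ‖w‖ ≠ 0 := norm_ne_zero_iff.2 h0
    obtain ⟨J', hJ'⟩ := h.orthogonal_J (‖w‖⁻¹ • w) (by
      rw [real_inner_self_eq_norm_sq, norm_smul, norm_inv, norm_norm, inv_mul_cancel₀ hn, one_pow])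
    have h3 := hJ' v (J v)
    have h4 : inner ℝ (‖w‖⁻¹ • w) w = ‖w‖ := by
      rw [real_inner_smul_left, real_inner_self_eq_norm_sq]
      field_simp
    have h5 : inner ℝ (J' v) (J v) = ‖w‖ := h3.trans h4
    rw [← h5]
    calc _ ≤ ‖J' v‖ * ‖J v‖ := real_inner_le_norm _ _
      _ = _ := by rw [J'.norm_map, J.norm_map, sq]
  have h6 : ‖w - ‖v‖ ^ 2 • ζ‖ ^ 2 ≤ 0 := by
    rw [norm_sub_sq_real, real_inner_smul_right, real_inner_comm, h1, norm_smul, mul_pow,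
      ← real_inner_self_eq_norm_sq ζ, hζ, norm_pow, norm_norm]
    nlinarith [norm_nonneg w]
  have h7 : w = ‖v‖ ^ 2 • ζ := by
    rw [← sub_eq_zero, ← norm_eq_zero]
    exact pow_eq_zero_iff two_ne_zero |>.1 (le_antisymm h6 (sq_nonneg _))
  exact congrArg Subtype.val h7

/-- Circular arcs in the complex line spanned by `v` are horizontal projections of horizontal
curves of length `θ * ‖v‖`. -/
theorem IsHType.hasLength_arc (h : IsHType 𝔤) (hζ : inner ℝ ζ ζ = 1)
    (hJ : ∀ x y : horizontalSpace 𝔤, inner ℝ (J x) y = inner ℝ (ζ : 𝔤) ⁅(x : 𝔤), (y : 𝔤)⁆)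
    (v : horizontalSpace 𝔤) {θ : ℝ} (hθ : 0 ≤ θ) :
    HasLength (((Real.sin θ • (Real.cos θ • v + Real.sin θ • J v) : horizontalSpace 𝔤) : 𝔤)
      + ((θ - Real.sin θ * Real.cos θ) / 4 * ‖v‖ ^ 2) • (ζ : 𝔤)) (θ * ‖v‖) := by
  -- The projection runs through the angle `2θ` on a circle of radius `‖v‖ / 2` through 0; the
  -- `ζ`-coefficient is the area between arc and chord.
  refine ⟨fun t => (Real.sin (θ * t) * Real.cos (θ * t)) • (v : 𝔤)
      + (Real.sin (θ * t) * Real.sin (θ * t)) • (J v : 𝔤)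
      + ((θ * t - Real.sin (θ * t) * Real.cos (θ * t)) / 4 * ‖v‖ ^ 2) • (ζ : 𝔤),
    fun t => θ • ((Real.cos (θ * t) ^ 2 - Real.sin (θ * t) ^ 2) • v
      + (2 * Real.sin (θ * t) * Real.cos (θ * t)) • J v), ⟨?_, ?_⟩, ?_, ?_, ?_⟩
  · exact ContDiffOn.absolutelyContinuousOnInterval (by fun_prop)
  · refine Filter.Eventually.of_forall fun t _ => ?_
    have d0 : HasDerivAt (fun t : ℝ => θ * t) θ t := by
      simpa using (hasDerivAt_id t).const_mul θ
    have d1 := ((d0.sin.fun_mul d0.cos).smul_const (v : 𝔤)).fun_add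
      ((d0.sin.fun_mul d0.sin).smul_const (J v : 𝔤))
    have d2 := d1.fun_add ((((d0.fun_sub (d0.sin.fun_mul d0.cos)).div_const 4).mul_const
      (‖v‖ ^ 2)).smul_const (ζ : 𝔤))
    refine d2.congr_deriv ?_
    have hsk : ⁅(J v : 𝔤), (v : 𝔤)⁆ = -(‖v‖ ^ 2 • (ζ : 𝔤)) := by
      rw [← lie_skew, h.lie_J hζ hJ]
    simp only [leftField, Submodule.coe_smul, Submodule.coe_add, add_lie, smul_lie, lie_add,
      lie_smul, lie_self, coe_center_lie, h.lie_J hζ hJ, hsk]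
    have hsc := Real.sin_sq_add_cos_sq (θ * t)
    match_scalars
    · ring
    · ring
    · linear_combination -(θ * ‖v‖ ^ 2 / 4) * (2 * Real.sin (θ * t) ^ 2 + 1) * hsc
  · simp
  · simp only [mul_one, Submodule.coe_smul, Submodule.coe_add]
    module
  · have hn : ∀ t : ℝ, ‖θ • ((Real.cos (θ * t) ^ 2 - Real.sin (θ * t) ^ 2) • v
      + (2 * Real.sin (θ * t) * Real.cos (θ * t)) • J v)‖ = θ * ‖v‖ := by
      intro t
      rw [norm_smul, Real.norm_of_nonneg hθ]
      congr 1
      rw [← sq_eq_sq₀ (norm_nonneg _) (norm_nonneg _), norm_add_sq_real, norm_smul, norm_smul,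
        real_inner_smul_left, real_inner_smul_right, real_inner_comm, inner_self_J hJ, J.norm_map]
      simp only [mul_pow, Real.norm_eq_abs, sq_abs]
      have hsc := Real.sin_sq_add_cos_sq (θ * t)
      linear_combination ‖v‖ ^ 2 * (Real.sin (θ * t) ^ 2 + Real.cos (θ * t) ^ 2 + 1) * hsc
    simp only [hn, intervalIntegral.integral_const, sub_zero, one_smul]

end

theorem IsHType.exists_unit_center (h : IsHType 𝔤) (z : centerSpace 𝔤) :
    ∃ ζ : centerSpace 𝔤, inner ℝ ζ ζ = 1 ∧ z = ‖z‖ • ζ := by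
  have aux : ∀ w : centerSpace 𝔤, w ≠ 0 → inner ℝ (‖w‖⁻¹ • w) (‖w‖⁻¹ • w) = 1 := fun w hw => by
    rw [real_inner_self_eq_norm_sq, norm_smul, norm_inv, norm_norm,
      inv_mul_cancel₀ (norm_ne_zero_iff.2 hw), one_pow]
  rcases eq_or_ne z 0 with rfl | hz
  · obtain ⟨w, hw, hw0⟩ := Submodule.exists_mem_ne_zero_of_ne_bot h.center_ne_bot
    exact ⟨_, aux ⟨w, hw⟩ (by simpa using hw0), by simp⟩
  · exact ⟨_, aux z hz, by rw [smul_smul, mul_inv_cancel₀ (norm_ne_zero_iff.2 hz), one_smul]⟩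

theorem IsHType.exists_horizontal_norm (h : IsHType 𝔤) {r : ℝ} (hr : 0 ≤ r) :
    ∃ v : horizontalSpace 𝔤, ‖v‖ = r := by
  have : Nontrivial (horizontalSpace 𝔤) := by
    rw [Submodule.nontrivial_iff_ne_bot]
    intro hb
    refine h.center_ne_bot ?_
    rw [← h.span_bracket, Submodule.span_eq_bot]
    rintro _ ⟨x, hx, y, -, rfl⟩
    rw [hb, Submodule.mem_bot] at hx
    rw [hx, zero_lie]
  exact exists_norm_eq _ hr

/-! ### Trigonometric equation and inequalities for the arc angle. -/

theorem sin_mul_cos_le {θ : ℝ} (hθ : 0 ≤ θ) : Real.sin θ * Real.cos θ ≤ θ := by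
  have := Real.sin_le (x := 2 * θ) (by positivity)
  rw [Real.sin_two_mul] at this
  linarith

/-- Intermediate values: near 0 the left side is cubic and the right side quadratic, while at `π`
the right side vanishes. -/
theorem exists_arc_angle {p q : ℝ} (hp : 0 < p) (hq : 0 < q) :
    ∃ θ, 0 < θ ∧ θ < Real.pi ∧ (θ - Real.sin θ * Real.cos θ) * p = q * Real.sin θ ^ 2 := by
  have hpi := Real.pi_gt_three
  have hpi' := Real.pi_lt_four
  -- Chosen so that `m³ p ≤ q (m/2)²`, while `sin m ≥ m/2` and `m - sin m cos m ≤ m³`.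
  set m := min 1 (q / (4 * p)) with hm
  have hm0 : 0 < m := by positivity
  have hm1 : m ≤ 1 := min_le_left _ _
  have hmq : m * (4 * p) ≤ q := by
    rw [← le_div_iff₀ (by positivity)]; exact min_le_right _ _
  let f : ℝ → ℝ := fun θ => (θ - Real.sin θ * Real.cos θ) * p - q * Real.sin θ ^ 2
  have hf : Continuous f := by fun_prop
  have hsin : m / 2 ≤ Real.sin m := by
    have h1 := Real.mul_le_sin hm0.le (by linarith)
    refine le_trans ?_ h1
    rw [div_mul_eq_mul_div, div_le_div_iff₀ two_pos Real.pi_pos]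
    nlinarith
  have hcos := Real.one_sub_sq_div_two_le_cos (x := m)
  have hsin' := Real.sin_gt_sub_cube hm0
  have h1 : f m ≤ 0 := by
    have e1 : m - Real.sin m * Real.cos m ≤ m ^ 3 := by
      have : (m - m ^ 3 / 6) * (1 - m ^ 2 / 2) ≤ Real.sin m * Real.cos m := by
        have : 0 ≤ 1 - m ^ 2 / 2 := by nlinarith
        have : 0 ≤ Real.sin m := by linarith
        gcongr
      nlinarith [pow_pos hm0 3, pow_pos hm0 5]
    have e2 : (m / 2) ^ 2 ≤ Real.sin m ^ 2 := by gcongr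
    have e3 : q * (m / 2) ^ 2 ≤ q * Real.sin m ^ 2 := by gcongr
    have e4 : (m - Real.sin m * Real.cos m) * p ≤ m ^ 3 * p := by gcongr
    have e5 : m ^ 3 * p ≤ q * (m / 2) ^ 2 := by nlinarith [pow_pos hm0 2]
    simp only [f]
    linarith
  have h2 : 0 < f Real.pi := by
    simp only [f, Real.sin_pi]
    nlinarith [mul_pos Real.pi_pos hp]
  obtain ⟨θ, hθ, hfθ⟩ := intermediate_value_Icc (by linarith) hf.continuousOn ⟨h1, h2.le⟩
  refine ⟨θ, hm0.trans_le hθ.1, lt_of_le_of_ne hθ.2 ?_, sub_eq_zero.1 hfθ⟩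
  rintro rfl
  exact h2.ne' hfθ

/-- If `cos θ ≤ sin θ`, then `θ² ≤ πθ` is enough. Otherwise `θ ≤ π/4`, and `sin θ ≥ 4θ/5` makes the
`sin²` term suffice since `16π/25 > 1`. -/
theorem sq_le_pi_mul {θ : ℝ} (h0 : 0 ≤ θ) (hθ : θ ≤ Real.pi) :
    θ ^ 2 ≤ Real.pi * (Real.sin θ ^ 2 + (θ - Real.sin θ * Real.cos θ)) := by
  have hpi := Real.pi_gt_three
  have hpi' := Real.pi_lt_four
  have hs := Real.sin_nonneg_of_nonneg_of_le_pi h0 hθ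
  rcases le_total (Real.cos θ) (Real.sin θ) with h | h
  · nlinarith [mul_nonneg hs (sub_nonneg.2 h)]
  · have h1 := sin_mul_cos_le h0
    have h4 : θ ≤ Real.pi / 4 := by
      by_contra! hc
      have e1 : 0 < Real.sin (θ - Real.pi / 4) :=
        Real.sin_pos_of_pos_of_lt_pi (by linarith) (by linarith)
      rw [Real.sin_sub, Real.cos_pi_div_four, Real.sin_pi_div_four] at e1
      nlinarith [Real.sqrt_nonneg 2]
    have h2 : θ * (4 / 5) ≤ Real.sin θ := by
      have := Real.one_sub_sq_div_two_le_cos (x := θ)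
      rcases h0.eq_or_lt with rfl | h0'
      · simp
      have := Real.sin_gt_sub_cube h0'
      nlinarith [mul_nonneg h0 (mul_nonneg (sub_nonneg.2 h4) (by linarith : 0 ≤ θ + Real.pi / 4))]
    have h3 : (θ * (4 / 5)) ^ 2 ≤ Real.sin θ ^ 2 := by gcongr
    nlinarith [sq_nonneg θ]

theorem sq_le_arc {θ ε : ℝ} (h0 : 0 ≤ θ) (hθ : θ ≤ Real.pi) (hε : 0 < ε) (hε1 : ε < 1) :
    θ ^ 2 ≤ (1 + ε) * Real.sin θ ^ 2
      + 5 * Real.pi / ε * (θ - Real.sin θ * Real.cos θ) := by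
  have hpi := Real.pi_pos
  have hs := Real.sin_nonneg_of_nonneg_of_le_pi h0 hθ
  have hs' := Real.sin_le h0
  set s := Real.sin θ
  -- Young's inequality for `θ = s + (θ - s)`, with `1 + 1/ε ≤ 2/ε`.
  have h1 : θ ^ 2 ≤ (1 + ε) * s ^ 2 + 2 / ε * (θ - s) ^ 2 := by
    have : (1 + ε) * s ^ 2 + 2 / ε * (θ - s) ^ 2 - θ ^ 2
        = (ε * s - (θ - s)) ^ 2 / ε + (1 - ε) / ε * (θ - s) ^ 2 := by
      field_simp
      ring
    have h2 : 0 ≤ (1 - ε) / ε := div_nonneg (by linarith) hε.le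
    have : 0 ≤ (1 + ε) * s ^ 2 + 2 / ε * (θ - s) ^ 2 - θ ^ 2 := by
      rw [this]; positivity
    linarith
  have h3 : 2 * (θ - s) ^ 2 ≤ 5 * Real.pi * (θ - s * Real.cos θ) := by
    have e1 : θ - s ≤ θ - s * Real.cos θ := by nlinarith [Real.cos_le_one θ]
    have e2 : (θ - s) ^ 2 ≤ Real.pi * (θ - s) := by nlinarith
    nlinarith
  have h4 : 2 / ε * (θ - s) ^ 2 ≤ 5 * Real.pi / ε * (θ - s * Real.cos θ) := by
    rw [div_mul_eq_mul_div, div_mul_eq_mul_div]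
    gcongr
  linarith

/-- Every element is the endpoint of an arc: there are an angle and a radius realising it. -/
theorem IsHType.exists_hasLength (h : IsHType 𝔤) (x : horizontalSpace 𝔤) {z : centerSpace 𝔤}
    (hz : z ≠ 0) :
    ∃ θ r : ℝ, 0 ≤ θ ∧ θ ≤ Real.pi ∧ ‖x‖ ^ 2 = Real.sin θ ^ 2 * r ^ 2 ∧
      4 * ‖z‖ = (θ - Real.sin θ * Real.cos θ) * r ^ 2 ∧
      HasLength ((x : 𝔤) + (z : 𝔤)) (θ * r) := by
  obtain ⟨ζ, hζ, hzζ⟩ := h.exists_unit_center z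
  have hzζ' : (z : 𝔤) = ‖z‖ • (ζ : 𝔤) := congrArg Subtype.val hzζ
  obtain ⟨J, hJ⟩ := h.orthogonal_J ζ hζ
  have hpi := Real.pi_pos
  by_cases hx : x = 0
  -- For `x = 0` the arc is a full circle, in any horizontal direction.
  · obtain ⟨v, hv⟩ := h.exists_horizontal_norm (r := √(4 * ‖z‖ / Real.pi)) (by positivity)
    have hv2 : ‖v‖ ^ 2 = 4 * ‖z‖ / Real.pi := by rw [hv, Real.sq_sqrt (by positivity)]
    refine ⟨Real.pi, ‖v‖, hpi.le, le_rfl, by simp [hx], ?_, ?_⟩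
    · rw [hv2, Real.sin_pi]; field_simp; ring
    · convert h.hasLength_arc hζ hJ v hpi.le using 1
      rw [hv2, Real.sin_pi, hx, hzζ']
      simp only [zero_smul, zero_mul, sub_zero]
      congr 2
      field_simp
  · have hx2 : 0 < ‖x‖ ^ 2 := by positivity
    have hz0 : 0 < 4 * ‖z‖ := by positivity
    obtain ⟨θ, h0, hθ, he⟩ := exists_arc_angle hx2 hz0
    have hs : 0 < Real.sin θ := Real.sin_pos_of_pos_of_lt_pi h0 hθ
    have hsc := Real.sin_sq_add_cos_sq θ
    -- Solves `x = sin θ (cos θ + sin θ J) v`, using `J² = -1`.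
    let v : horizontalSpace 𝔤 := (Real.sin θ)⁻¹ • (Real.cos θ • x - Real.sin θ • J x)
    have hv : ‖v‖ ^ 2 = ‖x‖ ^ 2 / Real.sin θ ^ 2 := by
      rw [norm_smul, mul_pow, norm_sub_sq_real, norm_smul, norm_smul, real_inner_smul_left,
        real_inner_smul_right, real_inner_comm, inner_self_J hJ, J.norm_map]
      simp only [mul_pow, Real.norm_eq_abs, sq_abs, inv_pow]
      field_simp
      linear_combination ‖x‖ ^ 2 * hsc
    refine ⟨θ, ‖v‖, h0.le, hθ.le, ?_, ?_, ?_⟩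
    · rw [hv]; field_simp
    · rw [hv, mul_div_assoc', he]; field_simp
    · convert h.hasLength_arc hζ hJ v h0.le using 2
      · congr 1
        simp only [v, map_smul, map_sub, J_J hJ]
        match_scalars
        · field_simp
          linear_combination -hsc
        · field_simp
          ring
      · rw [hzζ', hv]
        congr 1
        rw [div_mul_div_comm, he]
        field_simp

/-! ### Two-sided estimates of the distance. -/

theorem IsHType.le_ccDist_sq (h : IsHType 𝔤) {θ : ℝ} (hθ : 0 < θ) (hθ' : θ < Real.pi)
    (x : horizontalSpace 𝔤) (z : centerSpace 𝔤) :
    θ * (Real.cos θ / Real.sin θ) * ‖x‖ ^ 2 + 4 * θ * ‖z‖ ≤ ccDist ((x : 𝔤) + (z : 𝔤)) ^ 2 := by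
  have := h.finiteDimensional
  obtain ⟨ζ, hζ, hz⟩ := h.exists_unit_center z
  obtain ⟨J, hJ⟩ := h.orthogonal_J ζ hζ
  have hiz : inner ℝ (ζ : 𝔤) (z : 𝔤) = ‖z‖ := by
    change inner ℝ ζ z = _
    conv_lhs => rw [hz]
    rw [real_inner_smul_right, hζ, mul_one]
  obtain ⟨ℓ, hℓ⟩ : ∃ ℓ, HasLength ((x : 𝔤) + (z : 𝔤)) ℓ := by
    rcases eq_or_ne z 0 with rfl | hz0
    · exact ⟨‖x‖, by simpa using hasLength_horizontal x⟩
    · obtain ⟨θ, r, -, -, -, -, hl⟩ := h.exists_hasLength x hz0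
      exact ⟨_, hl⟩
  refine HTypeGroup.le_ccDist_sq hℓ ?_
  rintro _ ⟨γ, a, hγ, h0, h1, rfl⟩
  have := hγ.le_length_sq h h0 hJ hθ hθ'
  rwa [h1, horizontalPart_add, inner_add_right, inner_center_horizontal, zero_add, hiz] at this

theorem IsHType.pi_div_four_mul_le (h : IsHType 𝔤) (x : horizontalSpace 𝔤) (z : centerSpace 𝔤) :
    Real.pi / 4 * (‖x‖ ^ 2 + 4 * ‖z‖) ≤ ccDist ((x : 𝔤) + (z : 𝔤)) ^ 2 := by
  have hpi := Real.pi_pos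
  refine le_trans (le_of_eq ?_)
    (h.le_ccDist_sq (θ := Real.pi / 4) (by positivity) (by linarith) x z)
  rw [Real.cos_pi_div_four, Real.sin_pi_div_four, div_self (by positivity)]
  ring

theorem IsHType.ccDist_sq_le_pi_mul (h : IsHType 𝔤) (x : horizontalSpace 𝔤)
    (z : centerSpace 𝔤) :
    ccDist ((x : 𝔤) + (z : 𝔤)) ^ 2 ≤ Real.pi * (‖x‖ ^ 2 + 4 * ‖z‖) := by
  rcases eq_or_ne z 0 with rfl | hz
  · have := (hasLength_horizontal x).ccDist_sq_le
    simp only [Submodule.coe_zero, add_zero, norm_zero, mul_zero]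
    nlinarith [Real.pi_gt_three, sq_nonneg ‖x‖]
  · obtain ⟨θ, r, h0, hθ, hx, hz', hl⟩ := h.exists_hasLength x hz
    refine hl.ccDist_sq_le.trans ?_
    rw [hx, hz', mul_pow, ← add_mul, ← mul_assoc]
    exact mul_le_mul_of_nonneg_right (sq_le_pi_mul h0 hθ) (sq_nonneg r)

theorem IsHType.le_ccDist_sq_of_lt_one (h : IsHType 𝔤) {ε : ℝ} (hε : 0 < ε) (hε1 : ε < 1)
    (x : horizontalSpace 𝔤) (z : centerSpace 𝔤) :
    (1 - ε) * ‖x‖ ^ 2 + Real.pi * ε * ‖z‖ ≤ ccDist ((x : 𝔤) + (z : 𝔤)) ^ 2 := by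
  have hpi := Real.pi_gt_three
  have hpi' := Real.pi_lt_four
  -- This makes `4θ = πε`, and `θ cot θ ≥ cos θ ≥ 1 - ε` follows when `θ ≤ ε < 1`.
  set θ := Real.pi * ε / 4 with hθ
  have h0 : 0 < θ := by positivity
  have hθε : θ ≤ ε := by rw [hθ]; nlinarith
  have hεθ : 3 / 4 * ε ≤ θ := by rw [hθ]; nlinarith
  have hθ1 : θ < Real.pi := by linarith
  refine le_trans ?_ (h.le_ccDist_sq h0 hθ1 x z)
  have hs := Real.sin_pos_of_pos_of_lt_pi h0 hθ1
  have hc := Real.one_sub_sq_div_two_le_cos (x := θ)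
  have h1 : 1 - ε ≤ θ * (Real.cos θ / Real.sin θ) := by
    rw [mul_div_assoc', le_div_iff₀ hs]
    have e1 : 1 - ε ≤ Real.cos θ := by nlinarith
    have e2 := Real.sin_le h0.le
    calc (1 - ε) * Real.sin θ ≤ (1 - ε) * θ := by
          have : 0 ≤ 1 - ε := by linarith
          gcongr
      _ ≤ Real.cos θ * θ := by gcongr
      _ = _ := mul_comm _ _
  have h2 : Real.pi * ε = 4 * θ := by rw [hθ]; ring
  rw [h2]
  gcongr

theorem IsHType.ccDist_sq_le_of_lt_one (h : IsHType 𝔤) {ε : ℝ} (hε : 0 < ε) (hε1 : ε < 1)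
    (x : horizontalSpace 𝔤) (z : centerSpace 𝔤) :
    ccDist ((x : 𝔤) + (z : 𝔤)) ^ 2 ≤ (1 + ε) * ‖x‖ ^ 2 + 20 * Real.pi / ε * ‖z‖ := by
  rcases eq_or_ne z 0 with rfl | hz
  · have := (hasLength_horizontal x).ccDist_sq_le
    simp only [Submodule.coe_zero, add_zero, norm_zero, mul_zero]
    nlinarith [sq_nonneg ‖x‖]
  · obtain ⟨θ, r, h0, hθ, hx, hz', hl⟩ := h.exists_hasLength x hz
    refine hl.ccDist_sq_le.trans ?_
    calc (θ * r) ^ 2 = θ ^ 2 * r ^ 2 := mul_pow _ _ _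
      _ ≤ ((1 + ε) * Real.sin θ ^ 2 + 5 * Real.pi / ε * (θ - Real.sin θ * Real.cos θ)) * r ^ 2 :=
        mul_le_mul_of_nonneg_right (sq_le_arc h0 hθ hε hε1) (sq_nonneg r)
      _ = (1 + ε) * (Real.sin θ ^ 2 * r ^ 2)
          + 5 * Real.pi / ε * ((θ - Real.sin θ * Real.cos θ) * r ^ 2) := by ring
      _ = _ := by rw [← hx, ← hz']; ring

/-! ### Optimality of the constants. -/

theorem IsHType.le_pi_div_four (h : IsHType 𝔤) {c : ℝ}
    (hc : ∀ (x : horizontalSpace 𝔤) (z : centerSpace 𝔤),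
      c * (‖x‖ ^ 2 + 4 * ‖z‖) ≤ ccDist ((x : 𝔤) + (z : 𝔤)) ^ 2) : c ≤ Real.pi / 4 := by
  obtain ⟨ζ, hζ, -⟩ := h.exists_unit_center 0
  obtain ⟨J, hJ⟩ := h.orthogonal_J ζ hζ
  obtain ⟨v, hv⟩ := h.exists_horizontal_norm zero_le_one
  have hζn : ‖ζ‖ = 1 := by
    rw [real_inner_self_eq_norm_sq] at hζ
    nlinarith [norm_nonneg ζ]
  obtain ⟨θ, hθ⟩ : ∃ θ, θ = Real.pi / 4 := ⟨_, rfl⟩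
  have h0 : 0 < θ := by rw [hθ]; positivity
  have hl := h.hasLength_arc hζ hJ v h0.le
  have h1 := hc (Real.sin θ • (Real.cos θ • v + Real.sin θ • J v))
    (((θ - Real.sin θ * Real.cos θ) / 4 * ‖v‖ ^ 2) • ζ)
  rw [Submodule.coe_smul_of_tower _ ζ] at h1
  replace h1 := h1.trans hl.ccDist_sq_le
  have h2 : ‖Real.sin θ • (Real.cos θ • v + Real.sin θ • J v)‖ ^ 2 = Real.sin θ ^ 2 := by
    rw [norm_smul, mul_pow, norm_add_sq_real, norm_smul, norm_smul, real_inner_smul_left,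
      real_inner_smul_right, real_inner_comm, inner_self_J hJ, J.norm_map, hv]
    simp only [mul_pow, Real.norm_eq_abs, sq_abs]
    linear_combination Real.sin θ ^ 2 * Real.sin_sq_add_cos_sq θ
  have h3 : 0 ≤ (θ - Real.sin θ * Real.cos θ) / 4 := by
    have := sin_mul_cos_le h0.le
    linarith
  rw [h2, norm_smul, hζn, hv, one_pow, mul_one, mul_one, mul_one, Real.norm_of_nonneg h3] at h1
  have h4 : Real.sin θ ^ 2 = Real.sin θ * Real.cos θ := by
    rw [hθ, Real.sin_pi_div_four, Real.cos_pi_div_four, sq]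
  rw [h4, mul_div_cancel₀ _ four_ne_zero, add_sub_cancel, sq] at h1
  rw [← hθ]
  exact le_of_mul_le_mul_right h1 h0

theorem IsHType.pi_le (h : IsHType 𝔤) {C : ℝ}
    (hC : ∀ (x : horizontalSpace 𝔤) (z : centerSpace 𝔤),
      ccDist ((x : 𝔤) + (z : 𝔤)) ^ 2 ≤ C * (‖x‖ ^ 2 + 4 * ‖z‖)) : Real.pi ≤ C := by
  obtain ⟨ζ, hζ, -⟩ := h.exists_unit_center 0
  have hζn : ‖ζ‖ = 1 := by
    rw [real_inner_self_eq_norm_sq] at hζ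
    nlinarith [norm_nonneg ζ]
  refine le_of_forall_lt_imp_le_of_dense fun θ hθ => ?_
  rcases le_or_gt θ 0 with h0 | h0
  · have h1 := (sq_nonneg _).trans (hC 0 ζ)
    rw [norm_zero, hζn] at h1
    linarith
  · have h1 := (h.le_ccDist_sq h0 hθ 0 ζ).trans (hC 0 ζ)
    rw [norm_zero, hζn] at h1
    linarith

end HTypeGroup

theorem mainTheorem5 {𝔤 : Type*} [HTypeGroup.InnerProductLieAlgebra 𝔤]
    (h𝔤 : HTypeGroup.IsHType 𝔤) :
    (∀ (x : HTypeGroup.horizontalSpace 𝔤) (z : HTypeGroup.centerSpace 𝔤),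
      Real.pi / 4 * (‖x‖ ^ 2 + 4 * ‖z‖) ≤ HTypeGroup.ccDist ((x : 𝔤) + (z : 𝔤)) ^ 2 ∧
      HTypeGroup.ccDist ((x : 𝔤) + (z : 𝔤)) ^ 2 ≤ Real.pi * (‖x‖ ^ 2 + 4 * ‖z‖)) ∧
    IsGreatest {c : ℝ | ∀ (x : HTypeGroup.horizontalSpace 𝔤) (z : HTypeGroup.centerSpace 𝔤),
      c * (‖x‖ ^ 2 + 4 * ‖z‖) ≤ HTypeGroup.ccDist ((x : 𝔤) + (z : 𝔤)) ^ 2} (Real.pi / 4) ∧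
    IsLeast {C : ℝ | ∀ (x : HTypeGroup.horizontalSpace 𝔤) (z : HTypeGroup.centerSpace 𝔤),
      HTypeGroup.ccDist ((x : 𝔤) + (z : 𝔤)) ^ 2 ≤ C * (‖x‖ ^ 2 + 4 * ‖z‖)} Real.pi ∧
    (∀ ε : ℝ, 0 < ε → ε < 1 →
      ∀ (x : HTypeGroup.horizontalSpace 𝔤) (z : HTypeGroup.centerSpace 𝔤),
        (1 - ε) * ‖x‖ ^ 2 + Real.pi * ε * ‖z‖ ≤ HTypeGroup.ccDist ((x : 𝔤) + (z : 𝔤)) ^ 2 ∧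
        HTypeGroup.ccDist ((x : 𝔤) + (z : 𝔤)) ^ 2 ≤
          (1 + ε) * ‖x‖ ^ 2 + 20 * Real.pi / ε * ‖z‖) := by
  exact ⟨fun x z => ⟨h𝔤.pi_div_four_mul_le x z, h𝔤.ccDist_sq_le_pi_mul x z⟩,
    ⟨h𝔤.pi_div_four_mul_le, fun _ hc => h𝔤.le_pi_div_four hc⟩,
    ⟨h𝔤.ccDist_sq_le_pi_mul, fun _ hC => h𝔤.pi_le hC⟩,
    fun _ hε hε1 x z => ⟨h𝔤.le_ccDist_sq_of_lt_one hε hε1 x z,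
      h𝔤.ccDist_sq_le_of_lt_one hε hε1 x z⟩⟩
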